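/- Let $G$ be a finite simple graph on $n$ vertices with minimum degree $\delta$ and girth $g$ (the length of a shortest cycle of $G$), and let $k$ be an integer such that $\delta \ge 2k \ge 4$ and $g \ge 3$. Put $t = \lfloor (g-1)/2 \rfloor$ and $$n_1^* = n_1^*(\delta, g) = \begin{cases} 1+\delta+\sum_{i=2}^{t}(\delta-1)^{i}, & \text{if } g = 2t+1,\\ 2+2(\delta-1)^{t}+\sum_{i=1}^{t-1}(\delta-1)^{i}, & \text{if } g = 2t+2, \end{cases}$$ where empty sums are $0$. Let $A$ be the adjacency matrix of $G$ and $D$ the diagonal matrix of its vertex degrees, and let $\lambda_i(G)$, $\mu_i(G)$ and $q_i(G)$ denote the $i$-th largest eigenvalue, counted with multiplicity, of $A$, of the Laplacian matrix $D-A$ and of the signless Laplacian matrix $D+A$, respectively. Let $\tau(G)$ be the maximum number of pairwise edge-disjoint spanning trees contained in $G$. Then each of the following holds. (i) If $\lambda_2(G) < \delta - \frac{2k-1}{n_1^*}$, then $\tau(G) \ge k$. (ii) If $\mu_{n-1}(G) > \frac{2k-1}{n_1^*}$, then $\tau(G) \ge k$. (iii) If $q_2(G) < 2\delta - \frac{2k-1}{n_1^*}$,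 then $\tau(G) \ge k$. -/

import Mathlib

namespace SpanningTreePacking

/-- `G` contains `m` pairwise edge-disjoint spanning trees. A spanning tree of `G` is a tree on the
whole vertex set of `G` all of whose edges are edges of `G`. -/
def HasPacking {V : Type*} (G : SimpleGraph V) (m : ℕ) : Prop :=
  ∃ T : Fin m → SimpleGraph V,
    (∀ i, T i ≤ G ∧ (T i).IsTree) ∧
    (∀ i j, i ≠ j → Disjoint (T i).edgeSet (T j).edgeSet)

/-- The spanning tree packing number `τ(G)`: the maximum number of edge-disjoint spanning trees
contained in `G`. It is a natural number as soon as `G` is finite with at least two vertices; for a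
graph on a single vertex it is `⊤`. -/
noncomputable def tau {V : Type*} (G : SimpleGraph V) : ℕ∞ :=
  ⨆ (m : ℕ) (_ : HasPacking G m), (m : ℕ∞)

/-- The number `n₁*(δ, g)`, for `δ ≥ 1` and `g ≥ 3`, where `t = ⌊(g - 1) / 2⌋`: the first formula
is for odd `g`, that is `g = 2t + 1`, the second one for even `g`, that is `g = 2t + 2`. -/
def nOneStar (δ g : ℕ) : ℕ :=
  let t := (g - 1) / 2
  if g = 2 * t + 1 then
    1 + δ + ∑ i ∈ Finset.Icc 2 t, (δ - 1) ^ i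
  else
    2 + 2 * (δ - 1) ^ t + ∑ i ∈ Finset.Icc 1 (t - 1), (δ - 1) ^ i

section Eigenvalues

variable {V : Type*} [Fintype V] [DecidableEq V]

/-- The `i`-th largest eigenvalue, counted with multiplicity and `1 ≤ i ≤ n`, of a real symmetric
`n × n` matrix (`Matrix.IsHermitian.eigenvalues₀` lists the eigenvalues in non-increasing order,
starting from index `0`). It is `0` by convention for `i` outside that range. -/
noncomputable def ithLargestEigenvalue {M : Matrix V V ℝ} (hM : M.IsHermitian) (i : ℕ) : ℝ :=
  if h : 1 ≤ i ∧ i ≤ Fintype.card V then hM.eigenvalues₀ ⟨i - 1, by omega⟩ else 0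

variable (G : SimpleGraph V) [DecidableRel G.Adj]

/-- The signless Laplacian matrix `Q(G) = D(G) + A(G)`. -/
def signlessLapMatrix : Matrix V V ℝ := G.degMatrix ℝ + G.adjMatrix ℝ

theorem isHermitian_signlessLapMatrix : (signlessLapMatrix G).IsHermitian :=
  (G.isHermitian_degMatrix ℝ).add (G.isHermitian_adjMatrix ℝ)

/-- `λ_i(G)`: the `i`-th largest eigenvalue of the adjacency matrix `A(G)`. -/
noncomputable def adjEigenvalue (i : ℕ) : ℝ :=
  ithLargestEigenvalue (G.isHermitian_adjMatrix ℝ) i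

/-- `μ_i(G)`: the `i`-th largest eigenvalue of the Laplacian matrix `L(G) = D(G) - A(G)`. -/
noncomputable def lapEigenvalue (i : ℕ) : ℝ :=
  ithLargestEigenvalue (G.isHermitian_lapMatrix ℝ) i

/-- `q_i(G)`: the `i`-th largest eigenvalue of the signless Laplacian matrix `Q(G)`. -/
noncomputable def signlessLapEigenvalue (i : ℕ) : ℝ :=
  ithLargestEigenvalue (isHermitian_signlessLapMatrix G) i

end Eigenvalues

end SpanningTreePacking

/-! The proof is by contraposition. If `G` does not contain `k` edge-disjoint spanning trees, the
Nash-Williams–Tutte theorem (`exists_partition_of_not_hasPacking`) gives a partition into s parts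
with ∑ d(P) ≤ 2k(s - 1) - 2, where d(P) is the number of edges leaving P. That theorem is obtained
from matroid union, applied to the vectors 1_a - 1_b of the edges.

Put m = 2k - 1 and let S be a part with d(S) minimal. If e(S, T) ≥ 2k - d(T) held for every other
part T, summing over T would give ∑ d(P) ≥ 2k(s - 1). So some T satisfies d(S), d(T) ≤ m and e(S,
T)² ≤ (m - d(S))(m - d(T)) (`exists_pair_of_sum_le`). This is the condition that makes the Laplacian
form at α 1_S + β 1_T at most m(α² + β²).

Since m < δ, a Moore-type count that tolerates fewer than δ outgoing edges (`nOneStar_le_card`)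
shows that S and T have at least n₁* vertices. Hence the Laplacian form is at most (m / n₁*)|x|² on
a plane, and the Courant–Fischer principle bounds μ_{n-1}. Writing A = D - L and D + A = 2D - L with
D ≥ δ bounds λ₂ and q₂ on the same plane. -/

namespace SpanningTreePacking

/-! ### Matroid union for copies of a linear matroid -/

section LinearPacking

variable {K W E : Type*} [DivisionRing K] [AddCommGroup W] [Module K W]

/-- Expand `v x` in the independent family on `S`. If `e` has a nonzero coefficient, uniqueness of
the expansion keeps `v x` out of the span of `S \ {e}`, so `x` can replace `e` and `e` lies in `R`.
-/
theorem mem_span_inter_of_exchange {v : E → W} {S R : Set E} {x : E}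
    (hS : LinearIndepOn K v S) (hx : v x ∈ Submodule.span K (v '' S))
    (hR : ∀ e ∈ S, LinearIndepOn K v (insert x (S \ {e})) → e ∈ R) :
    v x ∈ Submodule.span K (v '' (S ∩ R)) := by
  classical
  rw [Finsupp.mem_span_image_iff_linearCombination] at hx ⊢
  obtain ⟨l, hl, hlx⟩ := hx
  refine ⟨l, ?_, hlx⟩
  rw [Finsupp.mem_supported] at hl ⊢
  intro e he
  refine ⟨hl he, hR e (hl he) ?_⟩
  refine (hS.mono Set.sdiff_subset).insert fun hmem => ?_
  rw [Finsupp.mem_span_image_iff_linearCombination] at hmem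
  obtain ⟨l', hl', hlx'⟩ := hmem
  rw [Finsupp.mem_supported] at hl'
  have h0 : l - l' = 0 := by
    refine linearIndepOn_iff.1 hS _ (Submodule.sub_mem _ ?_ ?_) (by simp [hlx, hlx'])
    · exact (Finsupp.mem_supported _ _).2 hl
    · exact (Finsupp.mem_supported _ _).2 (hl'.trans Set.sdiff_subset)
  rw [sub_eq_zero.1 h0] at he
  exact (hl' he).2 rfl

/-- A partial colouring all of whose colour classes are linearly independent. -/
def IsIndepColoring (K : Type*) {W E : Type*} [DivisionRing K] [AddCommGroup W] [Module K W]
    (v : E → W) {k : ℕ} (c : E → Option (Fin k)) : Prop :=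
  ∀ i, LinearIndepOn K v {a | c a = some i}

/-- `c'` arises from `c` by giving the colour `i` of `e` to the uncoloured element `x` instead. -/
def ExchangeStep [DecidableEq E] (K : Type*) {W : Type*} [DivisionRing K] [AddCommGroup W]
    [Module K W] (v : E → W) {k : ℕ} (c c' : E → Option (Fin k)) : Prop :=
  ∃ x e i, c x = none ∧ c e = some i ∧
    LinearIndepOn K v (insert x ({a | c a = some i} \ {e})) ∧
    c' = Function.update (Function.update c e none) x (some i)

variable [DecidableEq E] {v : E → W} {k : ℕ} {c c' : E → Option (Fin k)}

theorem ExchangeStep.isIndepColoring (h : ExchangeStep K v c c') (hc : IsIndepColoring K v c) :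
    IsIndepColoring K v c' := by
  obtain ⟨x, e, i, hx, he, hi, rfl⟩ := h
  intro j
  by_cases hj : j = i
  · subst hj
    convert hi using 1
    ext a
    by_cases hax : a = x <;> by_cases hae : a = e <;> simp [Function.update_apply, hax, hae]
  · refine (hc j).mono fun a ha => ?_
    by_cases hax : a = x
    · simp [hax, Ne.symm hj] at ha
    · by_cases hae : a = e <;> simp_all [Function.update_apply]

theorem ExchangeStep.card_eq [Fintype E] (h : ExchangeStep K v c c') :
    (Finset.univ.filter fun a => c' a ≠ none).card =
      (Finset.univ.filter fun a => c a ≠ none).card := by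
  obtain ⟨x, e, i, hx, he, hi, rfl⟩ := h
  have hxe : x ≠ e := by rintro rfl; simp [hx] at he
  have : (Finset.univ.filter fun a =>
      Function.update (Function.update c e none) x (some i) a ≠ none) =
      insert x ((Finset.univ.filter fun a => c a ≠ none).erase e) := by
    ext a
    by_cases hax : a = x <;> by_cases hae : a = e <;> simp [Function.update_apply, hax, hae]
  rw [this, Finset.card_insert_of_notMem (by simp [hx]), Finset.card_erase_add_one (by simp [he])]

/-- The tight set of the matroid union theorem, for `k` copies of a linear matroid. -/
theorem exists_isIndepColoring_tight [Fintype E] (K : Type*) [DivisionRing K] [Module K W]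
    (v : E → W) (k : ℕ) : ∃ (c : E → Option (Fin k)) (R : Set E), IsIndepColoring K v c ∧
      (∀ a ∉ R, c a ≠ none) ∧
      ∀ i, ∀ a ∈ R, v a ∈ Submodule.span K (v '' ({b | c b = some i} ∩ R)) := by
  obtain ⟨c₀, hc₀, hmax⟩ := Set.exists_max_image {c : E → Option (Fin k) | IsIndepColoring K v c}
    (fun c => (Finset.univ.filter fun a => c a ≠ none).card) (Set.toFinite _)
    ⟨fun _ => none, fun i => by simp⟩
  let Reach := Relation.ReflTransGen (ExchangeStep (k := k) K v)
  have hinv : ∀ c, Reach c₀ c → IsIndepColoring K v c ∧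
      (Finset.univ.filter fun a => c a ≠ none).card =
        (Finset.univ.filter fun a => c₀ a ≠ none).card := by
    intro c h
    induction h with
    | refl => exact ⟨hc₀, rfl⟩
    | tail _ h ih => exact ⟨h.isIndepColoring ih.1, h.card_eq.trans ih.2⟩
  -- Augmenting-path closure: the elements that some sequence of exchanges leaves uncoloured.
  let R : Set E := {x | ∃ c, Reach c₀ c ∧ c x = none}
  have hspan : ∀ c, Reach c₀ c → ∀ x, c x = none → ∀ i,
      v x ∈ Submodule.span K (v '' ({b | c b = some i} ∩ R)) := by
    intro c hc x hx i
    have hci := (hinv c hc).1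
    refine mem_span_inter_of_exchange (hci i) ?_ ?_
    -- Otherwise `x` could receive colour `i`, although exchanges preserve the maximal number of
    -- coloured elements.
    · by_contra hnot
      have hins := (hci i).insert hnot
      have hvalid : IsIndepColoring K v (Function.update c x (some i)) := by
        intro j
        by_cases hj : j = i
        · subst hj
          convert hins using 1
          ext a
          by_cases hax : a = x <;> simp [Function.update_apply, hax]
        · refine (hci j).mono fun a ha => ?_
          by_cases hax : a = x
          · simp [hax, Ne.symm hj] at ha
          · simpa [Function.update_apply, hax] using ha
      have hle := hmax _ hvalid
      have hset : (Finset.univ.filter fun a => Function.update c x (some i) a ≠ none) =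
          insert x (Finset.univ.filter fun a => c a ≠ none) := by
        ext a
        by_cases hax : a = x <;> simp [Function.update_apply, hax]
      simp only [hset] at hle
      rw [Finset.card_insert_of_notMem (by simp [hx]), (hinv c hc).2] at hle
      omega
    · intro e he hind
      have hxe : e ≠ x := by rintro rfl; simp [hx] at he
      exact ⟨_, hc.tail ⟨x, e, i, hx, he, hind, rfl⟩, by simp [hxe]⟩
  refine ⟨c₀, R, hc₀, fun a ha h => ha ⟨c₀, .refl, h⟩, ?_⟩
  -- Exchanges do not enlarge these spans, since the incoming element is already spanned inside `R`
  -- by `hspan`; this carries `hspan` back to `c₀`.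
  have hmono : ∀ c, Reach c₀ c → ∀ i, Submodule.span K (v '' ({b | c b = some i} ∩ R)) ≤
      Submodule.span K (v '' ({b | c₀ b = some i} ∩ R)) := by
    intro c hc
    induction hc with
    | refl => exact fun i => le_rfl
    | @tail c c' hc h ih =>
      intro i
      refine le_trans ?_ (ih i)
      obtain ⟨x, e, j, hx, he, hj, rfl⟩ := h
      rw [Submodule.span_le]
      rintro _ ⟨a, ⟨ha, haR⟩, rfl⟩
      by_cases hax : a = x
      · subst hax
        exact hspan c hc a hx i
      · refine Submodule.subset_span ⟨a, ⟨?_, haR⟩, rfl⟩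
        by_cases hae : a = e <;> simp_all [Function.update_apply]
  rintro i a ⟨c, hc, hca⟩
  exact hmono c hc i (hspan c hc a hca i)

end LinearPacking

/-! ### The graphic matroid over the reals -/

section EdgeVectors

variable {V : Type*} [DecidableEq V]

/-- The vector `1_a - 1_b` of an edge `ab`, for an arbitrary choice of its orientation. -/
noncomputable def edgeVector (e : Sym2 V) : V → ℝ :=
  Pi.single e.out.1 1 - Pi.single e.out.2 1

theorem edgeVector_dotProduct_eq_zero_iff [Fintype V] (a b : V) (x : V → ℝ) :
    edgeVector s(a, b) ⬝ᵥ x = 0 ↔ x a = x b := by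
  have h : edgeVector s(a, b) ⬝ᵥ x = x (s(a, b).out.1) - x (s(a, b).out.2) := by
    simp [edgeVector, sub_dotProduct]
  rw [h, sub_eq_zero]
  have h2 : s(s(a, b).out.1, s(a, b).out.2) = s(a, b) := Quot.out_eq _
  rcases Sym2.eq_iff.1 h2 with ⟨h3, h4⟩ | ⟨h3, h4⟩ <;> rw [h3, h4]
  exact eq_comm

/-- Rank–nullity for the incidence matrix: its kernel consists of the functions constant along
edges, which is the Laplacian kernel, of dimension the number of components. Loops contribute the
zero vector. -/
theorem finrank_span_edgeVector [Fintype V] (S : Set (Sym2 V)) :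
    Module.finrank ℝ (Submodule.span ℝ (edgeVector '' S)) +
      Nat.card (SimpleGraph.fromEdgeSet S).ConnectedComponent = Fintype.card V := by
  classical
  let M : Matrix S V ℝ := fun e => edgeVector e.1
  have hrank : M.rank = Module.finrank ℝ (Submodule.span ℝ (edgeVector '' S)) := by
    rw [Matrix.rank_eq_finrank_span_row, Set.image_eq_range]
    rfl
  have hker : LinearMap.ker M.mulVecLin =
      LinearMap.ker ((SimpleGraph.fromEdgeSet S).lapMatrix ℝ).toLin' := by
    ext x
    rw [LinearMap.mem_ker, LinearMap.mem_ker, Matrix.toLin'_apply,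
      SimpleGraph.lapMatrix_mulVec_eq_zero_iff_forall_adj, Matrix.mulVecLin_apply]
    constructor
    · intro h a b hab
      exact (edgeVector_dotProduct_eq_zero_iff a b x).1
        (congrFun h ⟨s(a, b), ((SimpleGraph.fromEdgeSet_adj S).1 hab).1⟩)
    · intro h
      ext ⟨e, he⟩
      induction e using Sym2.ind with
      | _ a b =>
        refine (edgeVector_dotProduct_eq_zero_iff a b x).2 ?_
        by_cases hab : a = b
        · rw [hab]
        · exact h a b ((SimpleGraph.fromEdgeSet_adj S).2 ⟨he, hab⟩)
  have hrn := LinearMap.finrank_range_add_finrank_ker M.mulVecLin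
  rw [hker, ← SimpleGraph.card_connectedComponent_eq_finrank_ker_toLin'_lapMatrix,
    Module.finrank_fintype_fun_eq_card] at hrn
  rw [← hrank, ← hrn, Nat.card_eq_fintype_card]
  rfl

theorem isTree_fromEdgeSet_of_linearIndepOn [Fintype V] {S : Set (Sym2 V)}
    (hS : LinearIndepOn ℝ edgeVector S) (hcard : S.ncard + 1 = Fintype.card V) :
    (SimpleGraph.fromEdgeSet S).IsTree := by
  classical
  have hdiag : (SimpleGraph.fromEdgeSet S).edgeSet = S := by
    rw [SimpleGraph.edgeSet_fromEdgeSet, sdiff_eq_left, Set.disjoint_left]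
    intro e he hd
    refine hS.ne_zero he ?_
    induction e using Sym2.ind with
    | _ a b =>
      have hab : a = b := by simpa using hd
      subst hab
      refine dotProduct_eq_zero_iff.1 fun x => ?_
      exact (edgeVector_dotProduct_eq_zero_iff a a x).2 rfl
  have hr : Module.finrank ℝ (Submodule.span ℝ (edgeVector '' S)) = S.ncard := by
    rw [Set.image_eq_range, finrank_span_eq_card hS, Set.ncard_eq_toFinset_card', Set.toFinset_card]
  have h1 := finrank_span_edgeVector S
  rw [SimpleGraph.isTree_iff_connected_and_card, hdiag]
  refine ⟨?_, by rw [Nat.card_coe_set_eq, hcard, Nat.card_eq_fintype_card]⟩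
  have hc : Nat.card (SimpleGraph.fromEdgeSet S).ConnectedComponent = 1 := by omega
  rw [Nat.card_eq_one_iff_unique] at hc
  have : Nonempty V := Fintype.card_pos_iff.1 (by omega)
  obtain ⟨hc, -⟩ := hc
  exact (SimpleGraph.connected_iff _).2
    ⟨fun a b => SimpleGraph.ConnectedComponent.eq.1 (Subsingleton.elim _ _), this⟩

end EdgeVectors

/-! ### The Nash-Williams–Tutte theorem -/

theorem card_colored_eq_sum {E : Type*} {k : ℕ} (c : E → Option (Fin k)) (T : Finset E) :
    (T.filter fun a => c a ≠ none).card = ∑ i, (T.filter fun a => c a = some i).card := by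
  simp_rw [Finset.card_filter]
  rw [Finset.sum_comm]
  refine Finset.sum_congr rfl fun a _ => ?_
  cases h : c a <;> simp

/-- The Nash-Williams-Tutte theorem: a graph without `k` edge-disjoint spanning trees has a vertex
partition with fewer than `k (s - 1)` crossing edges, where `s` is the number of parts. The crossing
edges are counted with both orientations. -/
theorem exists_partition_of_not_hasPacking {V : Type*} [Fintype V] [DecidableEq V] [Nonempty V]
    (G : SimpleGraph V) [DecidableRel G.Adj] {k : ℕ} (h : ¬ HasPacking G k) :
    ∃ H : SimpleGraph V,
      Nat.card {x : V × V // G.Adj x.1 x.2 ∧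
        H.connectedComponentMk x.1 ≠ H.connectedComponentMk x.2} + 2 * k + 2 ≤
      2 * k * Nat.card H.ConnectedComponent := by
  classical
  obtain ⟨c, R, hc, hR, hspan⟩ := exists_isIndepColoring_tight ℝ
    (fun e : G.edgeSet => edgeVector e.1) k
  let v : G.edgeSet → V → ℝ := fun e => edgeVector e.1
  let F : Fin k → Finset G.edgeSet := fun i => Finset.univ.filter fun a => c a = some i
  let H := SimpleGraph.fromEdgeSet (Subtype.val '' R)
  have himg : ∀ S : Set G.edgeSet, v '' S = edgeVector '' (Subtype.val '' S) := fun S => by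
    rw [Set.image_image]
  have hFrank : ∀ S : Set G.edgeSet, LinearIndepOn ℝ v S →
      Module.finrank ℝ (Submodule.span ℝ (v '' S)) = S.ncard := fun S hS => by
    rw [Set.image_eq_range, finrank_span_eq_card hS, Set.ncard_eq_toFinset_card', Set.toFinset_card]
  have hFle : ∀ i, (F i).card + 1 ≤ Fintype.card V := by
    intro i
    have h1 := finrank_span_edgeVector (Subtype.val '' {a | c a = some i})
    rw [← himg, hFrank _ (hc i), Set.ncard_eq_toFinset_card'] at h1
    have h2 : 0 < Nat.card (SimpleGraph.fromEdgeSet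
      (Subtype.val '' {a | c a = some i})).ConnectedComponent := Nat.card_pos
    have h3 : Set.toFinset {a | c a = some i} = F i := by ext; simp [F]
    rw [h3] at h1
    omega
  have hlt : ∃ i, (F i).card + 1 < Fintype.card V := by
    by_contra! hall
    refine h ⟨fun i => SimpleGraph.fromEdgeSet (Subtype.val '' {a | c a = some i}), ?_, ?_⟩
    · intro i
      constructor
      · rw [← SimpleGraph.edgeSet_subset_edgeSet, SimpleGraph.edgeSet_fromEdgeSet]
        refine Set.sdiff_subset.trans ?_
        rintro _ ⟨e, -, rfl⟩
        exact e.2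
      · refine isTree_fromEdgeSet_of_linearIndepOn ?_ ?_
        · exact LinearIndepOn.image_of_comp _ edgeVector (hc i)
        · rw [Set.ncard_image_of_injective _ Subtype.val_injective, Set.ncard_eq_toFinset_card']
          have h3 : Set.toFinset {a | c a = some i} = F i := by ext; simp [F]
          rw [h3]
          exact le_antisymm (hFle i) (hall i)
    · intro i j hij
      simp only [SimpleGraph.edgeSet_fromEdgeSet]
      refine Disjoint.mono Set.sdiff_subset Set.sdiff_subset ?_
      rw [Set.disjoint_image_iff Subtype.val_injective, Set.disjoint_left]
      intro a ha hb
      simp only [Set.mem_ofPred_eq] at ha hb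
      rw [ha] at hb
      exact hij (Option.some.inj hb)
  -- Each colour class restricted to `R` is a basis of the span of `R`, so it has n - s elements,
  -- with s the number of components of `H`.
  have hFR : ∀ i, ((Finset.univ.filter (· ∈ R)).filter fun a => c a = some i).card +
      Nat.card H.ConnectedComponent = Fintype.card V := by
    intro i
    have h1 := finrank_span_edgeVector (Subtype.val '' R)
    have h2 : Submodule.span ℝ (v '' R) =
        Submodule.span ℝ (v '' ({b | c b = some i} ∩ R)) := by
      apply le_antisymm
      · rw [Submodule.span_le]
        rintro _ ⟨a, ha, rfl⟩
        exact hspan i a ha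
      · exact Submodule.span_mono (Set.image_mono Set.inter_subset_right)
    rw [← himg, h2, hFrank _ ((hc i).mono Set.inter_subset_left),
      Set.ncard_eq_toFinset_card'] at h1
    convert h1 using 3
    ext a
    simp [and_comm]
  have hcol : (Finset.univ.filter fun a => c a ≠ none).card = ∑ i, (F i).card :=
    card_colored_eq_sum c _
  have hsplit : (Finset.univ.filter fun a => c a ≠ none).card =
      (Finset.univ.filter (· ∉ R)).card +
      ((Finset.univ.filter (· ∈ R)).filter fun a => c a ≠ none).card := by
    rw [← Finset.card_union_of_disjoint]
    · congr 1
      ext a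
      by_cases ha : a ∈ R
      · simp [ha]
      · simp [ha, hR a ha]
    · rw [Finset.disjoint_left]
      intro a ha hb
      simp at ha hb
      exact ha hb.1
  rw [hcol, card_colored_eq_sum c] at hsplit
  have hsum : ∑ i, ((Finset.univ.filter (· ∈ R)).filter fun a => c a = some i).card +
      k * Nat.card H.ConnectedComponent = k * Fintype.card V := by
    have := Finset.sum_congr (rfl : (Finset.univ : Finset (Fin k)) = _) fun i _ => hFR i
    simpa [Finset.sum_add_distrib] using this
  have hsum' : ∑ i, (F i).card + k < k * Fintype.card V := by
    have : ∑ i, ((F i).card + 1) < ∑ _i : Fin k, Fintype.card V :=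
      Finset.sum_lt_sum (fun i _ => hFle i) ⟨hlt.choose, Finset.mem_univ _, hlt.choose_spec⟩
    simpa [Finset.sum_add_distrib] using this
  -- All elements outside `R` are coloured, so their number is ∑|F i| - ∑|F i ∩ R| < k(n - 1) - k(n
  -- - s) = k(s - 1). Edges in `R` do not cross, and each crossing edge is counted twice.
  refine ⟨H, ?_⟩
  have hcross : Nat.card {x : V × V // G.Adj x.1 x.2 ∧
      H.connectedComponentMk x.1 ≠ H.connectedComponentMk x.2} ≤
      2 * (Finset.univ.filter (· ∉ R)).card := by
    rw [Nat.card_eq_fintype_card, Fintype.card_subtype,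
      ← Finset.card_map (s := Finset.univ.filter (· ∉ R)) (Function.Embedding.subtype _)]
    refine Finset.card_le_mul_card_image_of_maps_to (f := fun x : V × V => s(x.1, x.2)) ?_ 2 ?_
    · rintro ⟨a, b⟩ hab
      simp only [Finset.mem_filter, Finset.mem_univ, true_and] at hab
      simp only [Finset.mem_map, Finset.mem_filter, Finset.mem_univ, true_and]
      refine ⟨⟨s(a, b), hab.1⟩, fun hmem => hab.2 ?_, rfl⟩
      refine SimpleGraph.ConnectedComponent.eq.2 (SimpleGraph.Adj.reachable ?_)
      exact (SimpleGraph.fromEdgeSet_adj _).2 ⟨⟨_, hmem, rfl⟩, hab.1.ne⟩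
    · intro e _
      induction e using Sym2.ind with
      | _ a b =>
        refine (Finset.card_le_card (t := {(a, b), (b, a)}) ?_).trans Finset.card_le_two
        rintro ⟨x, y⟩ hxy
        have := (Finset.mem_filter.1 hxy).2
        simpa using this
  have hks : 2 * k * Nat.card H.ConnectedComponent = 2 * (k * Nat.card H.ConnectedComponent) := by
    ring
  rw [hks]
  omega

/-! ### Short distinct paths create short cycles -/

section Girth

variable {V : Type*} {G : SimpleGraph V}

/-- The union of the two paths is not acyclic, and a cycle in it uses each edge of the union at most
once. -/
theorem egirth_le_of_isPath_of_ne {u w : V} {p q : G.Walk u w} (hp : p.IsPath) (hq : q.IsPath)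
    (hne : p ≠ q) : G.egirth ≤ ((p.length + q.length : ℕ) : ℕ∞) := by
  classical
  let S : Set (Sym2 V) := {e | e ∈ p.edges ++ q.edges}
  have hSG : S ⊆ G.edgeSet := fun e he => by
    rcases List.mem_append.1 he with he | he
    exacts [p.edges_subset_edgeSet he, q.edges_subset_edgeSet he]
  have hH : (SimpleGraph.fromEdgeSet S).edgeSet = S := by
    rw [SimpleGraph.edgeSet_fromEdgeSet, sdiff_eq_left, Set.disjoint_left]
    exact fun e he hd => G.not_isDiag_of_mem_edgeSet (hSG he) (by simpa using hd)
  have hpS : ∀ e ∈ p.edges, e ∈ (SimpleGraph.fromEdgeSet S).edgeSet := fun e he => by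
    rw [hH]; exact List.mem_append_left _ he
  have hqS : ∀ e ∈ q.edges, e ∈ (SimpleGraph.fromEdgeSet S).edgeSet := fun e he => by
    rw [hH]; exact List.mem_append_right _ he
  have hcyc : ¬ (SimpleGraph.fromEdgeSet S).IsAcyclic := by
    intro hac
    have heq := (hac.subsingleton_path u w).elim ⟨p.transfer _ hpS, hp.transfer hpS⟩
      ⟨q.transfer _ hqS, hq.transfer hqS⟩
    have heq' : p.transfer _ hpS = q.transfer _ hqS := congrArg Subtype.val heq
    refine hne (SimpleGraph.Walk.ext_support ?_)
    have := congrArg SimpleGraph.Walk.support heq'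
    simpa using this
  simp only [SimpleGraph.IsAcyclic, not_forall, not_not] at hcyc
  obtain ⟨a, c, hc⟩ := hcyc
  have hle : SimpleGraph.fromEdgeSet S ≤ G := by
    rw [← SimpleGraph.edgeSet_subset_edgeSet, hH]
    exact hSG
  refine (SimpleGraph.egirth_anti hle).trans ((SimpleGraph.egirth_le_length hc).trans ?_)
  have h1 : c.edges.toFinset.card = c.length := by
    rw [List.toFinset_card_of_nodup hc.isCircuit.isTrail.edges_nodup, SimpleGraph.Walk.length_edges]
  have h2 : c.edges.toFinset ⊆ (p.edges ++ q.edges).toFinset := fun e he => by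
    have := c.edges_subset_edgeSet (List.mem_toFinset.1 he)
    rw [hH] at this
    exact List.mem_toFinset.2 this
  have h3 := (Finset.card_le_card h2).trans (List.toFinset_card_le _)
  rw [h1, List.length_append, SimpleGraph.Walk.length_edges, SimpleGraph.Walk.length_edges] at h3
  exact_mod_cast h3

theorem eq_of_isPath_of_lt_egirth {m : ℕ} (hG : (m : ℕ∞) ≤ G.egirth) {u w : V}
    {p q : G.Walk u w} (hp : p.IsPath) (hq : q.IsPath) (hlt : p.length + q.length < m) : p = q := by
  by_contra hne
  have h := hG.trans (egirth_le_of_isPath_of_ne hp hq hne)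
  have : m ≤ p.length + q.length := by exact_mod_cast h
  omega

end Girth

/-! ### Tree-like levels below half the girth -/

section Levels

variable {V : Type*} [Fintype V] {H : SimpleGraph V} {t i j : ℕ} {u v w y : V}

open Classical in
/-- The vertices that can be reached from `u` by a path of length `i`. -/
noncomputable def level (H : SimpleGraph V) (u : V) (i : ℕ) : Finset V :=
  Finset.univ.filter fun w => ∃ p : H.Walk u w, p.IsPath ∧ p.length = i

theorem mem_level : w ∈ level H u i ↔ ∃ p : H.Walk u w, p.IsPath ∧ p.length = i := by
  simp [level]

theorem level_zero : level H u 0 = {u} := by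
  ext w
  rw [mem_level, Finset.mem_singleton]
  constructor
  · rintro ⟨p, -, hp⟩
    exact (SimpleGraph.Walk.eq_of_length_eq_zero hp).symm
  · rintro rfl
    exact ⟨.nil, .nil, rfl⟩

theorem adj_mem_level_one (h : H.Adj u w) : w ∈ level H u 1 :=
  mem_level.2 ⟨h.toWalk, h.isPath_toWalk, by simp⟩

theorem level_index_unique (hH : ((2 * t + 1 : ℕ) : ℕ∞) ≤ H.egirth) (hi : i ≤ t) (hj : j ≤ t)
    (hwi : w ∈ level H u i) (hwj : w ∈ level H u j) : i = j := by
  obtain ⟨p, hp, rfl⟩ := mem_level.1 hwi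
  obtain ⟨q, hq, rfl⟩ := mem_level.1 hwj
  rw [eq_of_isPath_of_lt_egirth hH hp hq (by omega)]

/-- The exceptional `z` is the predecessor of `w` on its path from `u`. Any other neighbour extends
the path, since meeting the path again would close a short cycle. -/
theorem exists_forall_adj_mem_level_succ (hH : ((2 * t + 1 : ℕ) : ℕ∞) ≤ H.egirth) (hi : i + 1 ≤ t)
    (hw : w ∈ level H u i) : ∃ z, ∀ y, H.Adj w y → y ≠ z → y ∈ level H u (i + 1) := by
  classical
  obtain ⟨p, hp, rfl⟩ := mem_level.1 hw
  refine ⟨p.penultimate, fun y hy hyz => mem_level.2 ⟨p.concat hy, hp.concat ?_ hy, by simp⟩⟩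
  intro hmem
  have hlen := p.length_dropUntil_le_length hmem
  have heq := eq_of_isPath_of_lt_egirth hH (hp.dropUntil hmem) hy.symm.isPath_toWalk (by
    simp only [SimpleGraph.Walk.length_cons, SimpleGraph.Walk.length_nil]; omega)
  have he : s(y, w) ∈ p.edges := by
    refine p.edges_dropUntil_subset_edges hmem ?_
    rw [heq]
    simp
  exact hyz (hp.eq_penultimate_of_mem_edges (by rwa [Sym2.eq_swap]))

theorem level_parent_unique (hH : ((2 * t + 1 : ℕ) : ℕ∞) ≤ H.egirth) (hi : i + 1 ≤ t)
    (hw : w ∈ level H u (i + 1)) (hv : v ∈ level H u i) (hy : y ∈ level H u i)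
    (hvw : H.Adj v w) (hyw : H.Adj y w) : v = y := by
  classical
  have key : ∀ {a} (p : H.Walk u a), p.length = i → p.IsPath → w ∉ p.support := by
    intro a p hpi hp hmem
    have h1 : w ∈ level H u (p.takeUntil w hmem).length :=
      mem_level.2 ⟨_, hp.takeUntil hmem, rfl⟩
    have h2 := p.length_takeUntil_le_length hmem
    have := level_index_unique hH (by omega) (by omega) hw h1
    omega
  obtain ⟨p, hp, hpi⟩ := mem_level.1 hv
  obtain ⟨q, hq, hqi⟩ := mem_level.1 hy
  have heq := eq_of_isPath_of_lt_egirth hH (hp.concat (key p hpi hp) hvw)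
    (hq.concat (key q hqi hq) hyw) (by simp only [SimpleGraph.Walk.length_concat]; omega)
  exact (SimpleGraph.Walk.concat_inj heq).1

/-- Every vertex of level `i` sends all but at most one of its edges to the next level, where by
uniqueness of parents no vertex is counted twice. -/
theorem sum_degree_level_le [DecidableRel H.Adj] (hH : ((2 * t + 1 : ℕ) : ℕ∞) ≤ H.egirth)
    (hi : i + 1 ≤ t) :
    ∑ w ∈ level H u i, H.degree w ≤ (level H u (i + 1)).card + (level H u i).card := by
  classical
  have h1 : ∀ w ∈ level H u i,
      H.degree w ≤ (H.neighborFinset w ∩ level H u (i + 1)).card + 1 := by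
    intro w hw
    obtain ⟨z, hz⟩ := exists_forall_adj_mem_level_succ hH hi hw
    rw [← H.card_neighborFinset_eq_degree]
    refine le_trans (Finset.card_le_card (t := insert z (H.neighborFinset w ∩ level H u (i + 1))) ?_)
      (Finset.card_insert_le _ _)
    intro y hy
    by_cases hyz : y = z
    · simp [hyz]
    · exact Finset.mem_insert_of_mem
        (Finset.mem_inter.2 ⟨hy, hz y ((H.mem_neighborFinset w y).1 hy) hyz⟩)
  refine (Finset.sum_le_sum h1).trans ?_
  rw [Finset.sum_add_distrib, Finset.sum_const, smul_eq_mul, mul_one]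
  refine Nat.add_le_add_right ?_ _
  rw [← Finset.card_biUnion]
  · refine Finset.card_le_card (Finset.biUnion_subset.2 fun w _ => Finset.inter_subset_right)
  · intro a ha b hb hab
    rw [Function.onFun, Finset.disjoint_left]
    intro y hya hyb
    rw [Finset.mem_inter, SimpleGraph.mem_neighborFinset] at hya hyb
    exact hab (level_parent_unique hH hi hya.2 ha hb hya.1 hyb.1)

theorem degree_le_card_level_one [DecidableRel H.Adj] : H.degree u ≤ (level H u 1).card := by
  rw [← H.card_neighborFinset_eq_degree]
  exact Finset.card_le_card fun y hy => adj_mem_level_one ((H.mem_neighborFinset u y).1 hy)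

theorem mul_card_level_le [DecidableRel H.Adj] {d : ℕ} {b : V → ℕ}
    (hH : ((2 * t + 1 : ℕ) : ℕ∞) ≤ H.egirth) (hi : i + 1 ≤ t)
    (hdeg : ∀ w ∈ level H u i, d + 1 ≤ H.degree w + b w) :
    d * (level H u i).card ≤ (level H u (i + 1)).card + ∑ w ∈ level H u i, b w := by
  have h1 := Finset.sum_le_sum hdeg
  rw [Finset.sum_const, Finset.sum_add_distrib, smul_eq_mul, mul_add] at h1
  have h2 := sum_degree_level_le (u := u) hH hi
  rw [mul_comm]
  omega

end Levels

/-! ### Growth of layers with losses -/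

theorem pow_mul_le_of_growth {d s t : ℕ} (hd : 1 ≤ d) {l β : ℕ → ℕ} (h1 : s ≤ l 1)
    (hstep : ∀ i, 1 ≤ i → i + 1 ≤ t → d * l i ≤ l (i + 1) + β i) (m : ℕ) (hm : m + 2 ≤ t) :
    d ^ (m + 1) * s ≤ l (m + 2) + d ^ m * ∑ j ∈ Finset.Icc 1 (m + 1), β j := by
  induction m with
  | zero =>
    have := hstep 1 le_rfl (by omega)
    have h2 : d * s ≤ d * l 1 := Nat.mul_le_mul_left _ h1
    simpa using h2.trans this
  | succ m ih =>
    have ih := Nat.mul_le_mul_left d (ih (by omega))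
    have h2 := hstep (m + 2) (by omega) (by omega)
    rw [Finset.sum_Icc_succ_top (by omega)]
    -- The newest loss has weight 1; it is overcharged so that all losses share one weight.
    have h3 : β (m + 2) ≤ d ^ (m + 1) * β (m + 2) := Nat.le_mul_of_pos_left _ (by positivity)
    calc d ^ (m + 1 + 1) * s = d * (d ^ (m + 1) * s) := by ring
      _ ≤ d * l (m + 2) + d ^ (m + 1) * ∑ j ∈ Finset.Icc 1 (m + 1), β j := by
        refine ih.trans (le_of_eq ?_); ring
      _ ≤ l (m + 2 + 1) + d ^ (m + 1) * (∑ j ∈ Finset.Icc 1 (m + 1), β j + β (m + 2)) := by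
        rw [mul_add]; omega

/-- A family of disjoint layers in `X` which grows by the factor `d`, up to a total loss of at
most `d`. -/
theorem card_ge_of_layers {V : Type*} [DecidableEq V] {X : Finset V} {A : ℕ → Finset V}
    {b : V → ℕ} {d s t : ℕ} (hd : 1 ≤ d) (ht : 1 ≤ t) (hAX : ∀ i ≤ t, A i ⊆ X)
    (hdisj : ∀ i ≤ t, ∀ j ≤ t, i ≠ j → Disjoint (A i) (A j)) (hb : ∑ v ∈ X, b v ≤ d)
    (hstep : ∀ i, 1 ≤ i → i + 1 ≤ t → d * (A i).card ≤ (A (i + 1)).card + ∑ w ∈ A i, b w)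
    (h1 : s + 1 ≤ (A 1).card) :
    (A 0).card + (s + 1) + ∑ i ∈ Finset.Icc 2 t, d ^ (i - 1) * s ≤ X.card := by
  have hgrow : ∀ i ∈ Finset.Icc 2 t, d ^ (i - 1) * s ≤ (A i).card := by
    intro i hi
    obtain ⟨h2, h3⟩ := Finset.mem_Icc.1 hi
    obtain ⟨m, rfl⟩ := Nat.exists_eq_add_of_le' h2
    have h4 := pow_mul_le_of_growth hd h1 hstep m h3
    have h5 : ∑ j ∈ Finset.Icc 1 (m + 1), ∑ w ∈ A j, b w ≤ d := by
      rw [← Finset.sum_biUnion]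
      · refine (Finset.sum_le_sum_of_subset (Finset.biUnion_subset.2 fun j hj => ?_)).trans hb
        exact hAX j (by have := Finset.mem_Icc.1 hj; omega)
      · intro i hi j hj hij
        have := Finset.mem_Icc.1 (Finset.mem_coe.1 hi)
        have := Finset.mem_Icc.1 (Finset.mem_coe.1 hj)
        exact hdisj i (by omega) j (by omega) hij
    -- The total loss costs at most d^(m+1), which is what the extra vertex in `s + 1 ≤ (A 1).card`
    -- pays for.
    have h6 : d ^ m * ∑ j ∈ Finset.Icc 1 (m + 1), ∑ w ∈ A j, b w ≤ d ^ (m + 1) := by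
      rw [pow_succ]; exact Nat.mul_le_mul_left _ h5
    rw [mul_add, mul_one] at h4
    have : m + 2 - 1 = m + 1 := by omega
    rw [this]
    omega
  have hsum : ∑ i ∈ Finset.range (t + 1), (A i).card ≤ X.card := by
    rw [← Finset.card_biUnion]
    · refine Finset.card_le_card (Finset.biUnion_subset.2 fun j hj => ?_)
      exact hAX j (by have := Finset.mem_range.1 hj; omega)
    · intro i hi j hj hij
      have := Finset.mem_range.1 (Finset.mem_coe.1 hi)
      have := Finset.mem_range.1 (Finset.mem_coe.1 hj)
      exact hdisj i (by omega) j (by omega) hij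
  have hsplit : ∑ i ∈ Finset.range (t + 1), (A i).card =
      (A 0).card + (A 1).card + ∑ i ∈ Finset.Icc 2 t, (A i).card := by
    have : Finset.range (t + 1) = insert 0 (insert 1 (Finset.Icc 2 t)) := by
      ext i; simp; omega
    rw [this, Finset.sum_insert (by simp), Finset.sum_insert (by simp), add_assoc]
  have := Finset.sum_le_sum hgrow
  omega

/-! ### A Moore bound for sets with few outgoing edges -/

section MooreBound

variable {V : Type*} {G : SimpleGraph V} {X : Finset V} {δ t : ℕ} {u v w : V}

/-- The graph of all edges of `G` inside `X`, on the whole vertex set of `G`. -/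
def inside (G : SimpleGraph V) (X : Finset V) : SimpleGraph V where
  Adj a b := G.Adj a b ∧ a ∈ X ∧ b ∈ X
  symm := ⟨fun _ _ h => ⟨h.1.symm, h.2.2, h.2.1⟩⟩
  loopless := ⟨fun _ h => h.1.ne rfl⟩

instance [DecidableEq V] [DecidableRel G.Adj] : DecidableRel (inside G X).Adj := fun a b =>
  inferInstanceAs (Decidable (G.Adj a b ∧ a ∈ X ∧ b ∈ X))

theorem inside_le : inside G X ≤ G := fun _ _ h => h.1

theorem level_subset_of_le_inside [Fintype V] {H : SimpleGraph V} (hH : H ≤ inside G X)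
    (hu : u ∈ X) (i : ℕ) :
    level H u i ⊆ X := by
  intro w hw
  obtain ⟨p, -, -⟩ := mem_level.1 hw
  clear hw
  induction p with
  | nil => exact hu
  | cons h _ ih => exact ih (hH h).2.2

variable [Fintype V] [DecidableEq V] [DecidableRel G.Adj]

/-- The number of neighbours of `v` outside `X`. -/
def outDegree (G : SimpleGraph V) [DecidableRel G.Adj] (X : Finset V) (v : V) : ℕ :=
  (G.neighborFinset v \ X).card

theorem degree_inside_add_outDegree (hv : v ∈ X) :
    (inside G X).degree v + outDegree G X v = G.degree v := by
  have h : (inside G X).neighborFinset v = G.neighborFinset v ∩ X := by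
    ext w
    rw [SimpleGraph.mem_neighborFinset, Finset.mem_inter, SimpleGraph.mem_neighborFinset]
    simp [inside, hv]
  rw [← SimpleGraph.card_neighborFinset_eq_degree, h, outDegree, Finset.card_inter_add_card_sdiff,
    SimpleGraph.card_neighborFinset_eq_degree]

/-- Otherwise 1 ≤ |X| ≤ δ - 1. Each vertex of X has at least δ + 1 - |X| outside neighbours, so
|X|(δ + 1 - |X|) ≤ δ - 1, but the left side is at least δ in this range. -/
theorem exists_outDegree_eq_zero (hδ : ∀ v, δ ≤ G.degree v) (hX : X.Nonempty)
    (hb : ∑ v ∈ X, outDegree G X v < δ) : ∃ u ∈ X, outDegree G X u = 0 := by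
  by_contra! hne
  have h1 : X.card ≤ ∑ v ∈ X, outDegree G X v := by
    rw [Finset.card_eq_sum_ones]
    exact Finset.sum_le_sum fun v hv => Nat.one_le_iff_ne_zero.2 (hne v hv)
  have h2 : ∀ v ∈ X, δ + 1 ≤ X.card + outDegree G X v := by
    intro v hv
    have h3 : (inside G X).degree v + 1 ≤ X.card := by
      rw [← SimpleGraph.card_neighborFinset_eq_degree,
        ← Finset.card_insert_of_notMem (SimpleGraph.notMem_neighborFinset_self _ v)]
      refine Finset.card_le_card (Finset.insert_subset hv fun w hw => ?_)
      exact ((SimpleGraph.mem_neighborFinset _ _ _).1 hw).2.2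
    have h4 := degree_inside_add_outDegree (G := G) hv
    have := hδ v
    omega
  have h3 := Finset.sum_le_sum h2
  simp only [Finset.sum_add_distrib, Finset.sum_const, smul_eq_mul] at h3
  have h4 : 1 ≤ X.card := hX.card_pos
  obtain ⟨a, ha⟩ := Nat.exists_eq_add_of_le h4
  obtain ⟨b, hb'⟩ := Nat.exists_eq_add_of_lt (h1.trans_lt hb)
  rw [hb', ha] at h3
  rw [hb', ha] at hb
  nlinarith [Nat.zero_le (a * b)]

theorem exists_adj_outDegree_eq_zero (hδ : ∀ v, δ ≤ G.degree v) (hu : u ∈ X)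
    (hu0 : outDegree G X u = 0) (hb : ∑ v ∈ X, outDegree G X v < δ) :
    ∃ v, (inside G X).Adj u v ∧ outDegree G X v = 0 := by
  by_contra! hne
  have h1 : (inside G X).degree u ≤ ∑ v ∈ X, outDegree G X v := by
    rw [← SimpleGraph.card_neighborFinset_eq_degree, Finset.card_eq_sum_ones]
    have hsub : (inside G X).neighborFinset u ⊆ X := fun w hw =>
      ((SimpleGraph.mem_neighborFinset _ _ _).1 hw).2.2
    refine (Finset.sum_le_sum fun v hv => ?_).trans (Finset.sum_le_sum_of_subset hsub)
    exact Nat.one_le_iff_ne_zero.2 (hne v ((SimpleGraph.mem_neighborFinset _ _ _).1 hv))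
  have h2 := degree_inside_add_outDegree (G := G) hu
  have := hδ u
  omega

/-- Grow levels from a vertex without outside neighbours, so that level 1 has at least δ vertices.
Later levels grow by the factor δ - 1, up to losses given by `outDegree`, which total at most δ - 1.
-/
theorem card_ge_of_odd_girth (hδ : ∀ v, δ ≤ G.degree v) (hδ2 : 2 ≤ δ) (ht : 1 ≤ t)
    (hg : ((2 * t + 1 : ℕ) : ℕ∞) ≤ G.egirth) (hX : X.Nonempty)
    (hb : ∑ v ∈ X, outDegree G X v < δ) :
    1 + δ + ∑ i ∈ Finset.Icc 2 t, (δ - 1) ^ i ≤ X.card := by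
  obtain ⟨u, hu, hu0⟩ := exists_outDegree_eq_zero hδ hX hb
  have hH : ((2 * t + 1 : ℕ) : ℕ∞) ≤ (inside G X).egirth :=
    hg.trans (SimpleGraph.egirth_anti inside_le)
  have hsub := level_subset_of_le_inside (H := inside G X) le_rfl hu
  have hdeg : ∀ w ∈ X, δ - 1 + 1 ≤ (inside G X).degree w + outDegree G X w := fun w hw => by
    rw [degree_inside_add_outDegree hw]
    have := hδ w
    omega
  have h := card_ge_of_layers (A := level (inside G X) u) (b := outDegree G X) (d := δ - 1)
    (s := δ - 1) (by omega) ht (fun i _ => hsub i) ?_ (by omega) ?_ ?_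
  · rw [level_zero, Finset.card_singleton] at h
    refine le_trans (le_of_eq ?_) h
    rw [Nat.sub_add_cancel (by omega)]
    congr 1
    refine Finset.sum_congr rfl fun i hi => ?_
    have := Finset.mem_Icc.1 hi
    rw [← pow_succ, Nat.sub_add_cancel (by omega)]
  · intro i hi j hj hij
    rw [Finset.disjoint_left]
    exact fun w hwi hwj => hij (level_index_unique hH hi hj hwi hwj)
  · exact fun i _ hi => mul_card_level_le hH hi fun w hw => hdeg w (hsub i hw)
  · have := hdeg u hu
    have := degree_le_card_level_one (H := inside G X) (u := u)
    omega

/-- Each summand on the right is 2d^i - d^(i-1), so neighbouring powers partly cancel. -/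
theorem two_mul_pow_add_sum {d t : ℕ} (hd : 1 ≤ d) (ht : 1 ≤ t) :
    2 + 2 * d ^ t + ∑ i ∈ Finset.Icc 1 (t - 1), d ^ i =
      2 + (2 * d - 1 + 1) + ∑ i ∈ Finset.Icc 2 t, d ^ (i - 1) * (2 * d - 1) := by
  obtain ⟨s, hs⟩ : ∃ s, 2 * d = s + 1 := ⟨2 * d - 1, by omega⟩
  rw [hs, Nat.add_sub_cancel]
  induction t, ht using Nat.le_induction with
  | base => simp [hs]
  | succ t ht ih =>
    rw [Finset.sum_Icc_succ_top (by omega), ← add_assoc, ← ih, Nat.add_sub_cancel]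
    obtain ⟨m, rfl⟩ := Nat.exists_eq_add_of_le' ht
    rw [Finset.sum_Icc_succ_top (by omega), Nat.add_sub_cancel]
    have : 2 * d ^ (m + 1 + 1) = (s + 1) * d ^ (m + 1) := by rw [← hs]; ring
    rw [this]
    ring

/-- Levels are grown from both ends of an edge `uv` whose ends have no outside neighbours. Deleting
that edge keeps the two trees apart, since a common vertex would close a cycle of length at most 2t
+ 1 through it. -/
theorem card_ge_of_even_girth (hδ : ∀ v, δ ≤ G.degree v) (hδ2 : 2 ≤ δ) (ht : 1 ≤ t)
    (hg : ((2 * t + 2 : ℕ) : ℕ∞) ≤ G.egirth) (hX : X.Nonempty)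
    (hb : ∑ v ∈ X, outDegree G X v < δ) :
    2 + 2 * (δ - 1) ^ t + ∑ i ∈ Finset.Icc 1 (t - 1), (δ - 1) ^ i ≤ X.card := by
  obtain ⟨u, hu, hu0⟩ := exists_outDegree_eq_zero hδ hX hb
  obtain ⟨v, huv, hv0⟩ := exists_adj_outDegree_eq_zero hδ hu hu0 hb
  have hv : v ∈ X := huv.2.2
  let H := (inside G X).deleteEdges {s(u, v)}
  have hHadj : ∀ a b, H.Adj a b ↔ (inside G X).Adj a b ∧ s(a, b) ≠ s(u, v) := fun a b => by
    simp [H, SimpleGraph.deleteEdges_adj]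
  have hle : H ≤ inside G X := SimpleGraph.deleteEdges_le _
  have hdec : DecidableRel H.Adj := fun a b => decidable_of_iff' _ (hHadj a b)
  have hgX : ((2 * t + 2 : ℕ) : ℕ∞) ≤ (inside G X).egirth :=
    hg.trans (SimpleGraph.egirth_anti inside_le)
  have hH : ((2 * t + 1 : ℕ) : ℕ∞) ≤ H.egirth :=
    le_trans (by norm_cast; omega) (hgX.trans (SimpleGraph.egirth_anti hle))
  have hnot : ∀ {a b} (p : H.Walk a b), s(u, v) ∉ p.edges := fun p hp =>
    ((hHadj u v).1 (p.adj_of_mem_edges hp)).2 rfl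
  have hfar : ∀ p : H.Walk u v, p.IsPath → 2 * t < p.length := by
    intro p hp
    by_contra! hlen
    have heq := eq_of_isPath_of_lt_egirth hgX (hp.mapLe hle) huv.isPath_toWalk (by simp; omega)
    have : s(u, v) ∈ (p.mapLe hle).edges := by rw [heq]; simp
    rw [SimpleGraph.Walk.edges_mapLe_eq_edges] at this
    exact hnot p this
  have hvu : ∀ {a} (p : H.Walk u a), p.IsPath → p.length ≤ t → v ∉ p.support := by
    intro a p hp hpt hmem
    have := hfar _ (hp.takeUntil hmem)
    have := p.length_takeUntil_le_length hmem
    omega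
  have huv' : ∀ {a} (p : H.Walk v a), p.IsPath → p.length ≤ t → u ∉ p.support := by
    intro a p hp hpt hmem
    have := hfar _ (hp.takeUntil hmem).reverse
    rw [SimpleGraph.Walk.length_reverse] at this
    have := p.length_takeUntil_le_length hmem
    omega
  have hdisj : ∀ i ≤ t, ∀ j ≤ t, Disjoint (level H u i) (level H v j) := by
    intro i hi j hj
    rw [Finset.disjoint_left]
    intro w hwi hwj
    obtain ⟨p, hp, rfl⟩ := mem_level.1 hwi
    obtain ⟨q, hq, rfl⟩ := mem_level.1 hwj
    have hq' : (SimpleGraph.Walk.cons huv (q.mapLe hle)).IsPath := by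
      rw [SimpleGraph.Walk.cons_isPath_iff]
      refine ⟨hq.mapLe hle, ?_⟩
      rw [SimpleGraph.Walk.support_mapLe_eq_support]
      exact huv' q hq hj
    have heq := eq_of_isPath_of_lt_egirth hgX (hp.mapLe hle) hq' (by simp; omega)
    have : s(u, v) ∈ (p.mapLe hle).edges := by rw [heq]; simp
    rw [SimpleGraph.Walk.edges_mapLe_eq_edges] at this
    exact hnot p this
  have hsame : ∀ a, ∀ i ≤ t, ∀ j ≤ t, i ≠ j → Disjoint (level H a i) (level H a j) := by
    intro a i hi j hj hij
    rw [Finset.disjoint_left]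
    exact fun w hwi hwj => hij (level_index_unique hH hi hj hwi hwj)
  have hdegX : ∀ w ∈ X, δ ≤ (inside G X).degree w + outDegree G X w := fun w hw => by
    rw [degree_inside_add_outDegree hw]
    exact hδ w
  have hdeg : ∀ w ∈ X, w ≠ u → w ≠ v → δ - 1 + 1 ≤ H.degree w + outDegree G X w := by
    intro w hw hwu hwv
    have : H.degree w = (inside G X).degree w := by
      rw [← SimpleGraph.card_neighborFinset_eq_degree, ← SimpleGraph.card_neighborFinset_eq_degree]
      congr 1
      ext y
      rw [SimpleGraph.mem_neighborFinset, SimpleGraph.mem_neighborFinset, hHadj]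
      simp [hwu, hwv]
    rw [this]
    have := hdegX w hw
    omega
  have hdegEnd : ∀ a b, s(a, b) = s(u, v) → (inside G X).degree a ≤ H.degree a + 1 := by
    intro a b hab
    rw [← SimpleGraph.card_neighborFinset_eq_degree, ← SimpleGraph.card_neighborFinset_eq_degree]
    refine le_trans (Finset.card_le_card (t := insert b (H.neighborFinset a)) fun y hy => ?_)
      (Finset.card_insert_le _ _)
    rw [Finset.mem_insert, SimpleGraph.mem_neighborFinset, hHadj, ← hab]
    rw [SimpleGraph.mem_neighborFinset] at hy
    by_cases hyb : y = b
    · exact Or.inl hyb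
    · refine Or.inr ⟨hy, fun h => hyb ?_⟩
      exact Sym2.congr_right.1 h
  have hsubu := level_subset_of_le_inside hle hu
  have hsubv := level_subset_of_le_inside hle hv
  have hcard : ∀ i ≤ t, (level H u i ∪ level H v i).card =
      (level H u i).card + (level H v i).card := fun i hi =>
    Finset.card_union_of_disjoint (hdisj i hi i hi)
  rw [two_mul_pow_add_sum (by omega) ht]
  have h := card_ge_of_layers (A := fun i => level H u i ∪ level H v i) (b := outDegree G X)
    (X := X) (d := δ - 1) (s := 2 * (δ - 1) - 1) (by omega) ht
    (fun i _ => Finset.union_subset (hsubu i) (hsubv i)) ?_ (by omega) ?_ ?_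
  · rw [hcard 0 (by omega), level_zero, level_zero] at h
    exact h
  · intro i hi j hj hij
    rw [Finset.disjoint_union_left, Finset.disjoint_union_right, Finset.disjoint_union_right]
    exact ⟨⟨hsame u i hi j hj hij, hdisj i hi j hj⟩,
      ⟨(hdisj j hj i hi).symm, hsame v i hi j hj hij⟩⟩
  · intro i hi1 hi
    simp only [hcard i (by omega), hcard (i + 1) (by omega)]
    rw [Finset.sum_union (hdisj i (by omega) i (by omega)), mul_add]
    -- Beyond level 0 neither `u` nor `v` occurs, so the deleted edge costs no degree there.
    have hu1 := mul_card_level_le (u := u) (d := δ - 1) (b := outDegree G X) hH hi fun w hw => by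
      refine hdeg w (hsubu i hw) ?_ ?_
      · rintro rfl
        have := level_index_unique hH (i := i) (j := 0) (by omega) (by omega) hw
          (by simp [level_zero])
        omega
      · rintro rfl
        exact Finset.disjoint_left.1 (hdisj i (by omega) 0 (by omega)) hw (by simp [level_zero])
    have hv1 := mul_card_level_le (u := v) (d := δ - 1) (b := outDegree G X) hH hi fun w hw => by
      refine hdeg w (hsubv i hw) ?_ ?_
      · rintro rfl
        exact Finset.disjoint_left.1 (hdisj 0 (by omega) i (by omega)) (by simp [level_zero]) hw
      · rintro rfl
        have := level_index_unique hH (i := i) (j := 0) (by omega) (by omega) hw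
          (by simp [level_zero])
        omega
    omega
  -- Each end has at least δ neighbours in `X` and loses one, so the first layer has at least 2(δ -
  -- 1) vertices.
  · simp only [hcard 1 ht]
    have := degree_le_card_level_one (H := H) (u := u)
    have := degree_le_card_level_one (H := H) (u := v)
    have := hdegEnd u v rfl
    have := hdegEnd v u Sym2.eq_swap
    have := hdegX u hu
    have := hdegX v hv
    omega

theorem nOneStar_le_card {g : ℕ} (hδ : ∀ v, δ ≤ G.degree v) (hδ2 : 2 ≤ δ) (hg3 : 3 ≤ g)
    (hg : (g : ℕ∞) ≤ G.egirth) (hX : X.Nonempty) (hb : ∑ v ∈ X, outDegree G X v < δ) :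
    nOneStar δ g ≤ X.card := by
  unfold nOneStar
  dsimp only
  have ht : 1 ≤ (g - 1) / 2 := by omega
  split_ifs with h
  · exact card_ge_of_odd_girth hδ hδ2 ht (by rwa [← h]) hX hb
  · have h2 : g = 2 * ((g - 1) / 2) + 2 := by omega
    exact card_ge_of_even_girth hδ hδ2 ht (by rwa [← h2]) hX hb

end MooreBound

/-! ### Courant–Fischer on a plane -/

section Spectral

open Matrix

variable {V : Type*} [Fintype V]

theorem exists_combination_orthogonal {y z : V → ℝ}
    (hyz : ∀ α β : ℝ, α • y + β • z = 0 → α = 0 ∧ β = 0) (w : V → ℝ) :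
    ∃ α β : ℝ, α • y + β • z ≠ 0 ∧ w ⬝ᵥ (α • y + β • z) = 0 := by
  by_cases hy : w ⬝ᵥ y = 0
  · exact ⟨1, 0, fun h => one_ne_zero (hyz 1 0 h).1, by simp [hy]⟩
  · refine ⟨w ⬝ᵥ z, -(w ⬝ᵥ y), fun h => hy (neg_eq_zero.1 (hyz _ _ h).2), ?_⟩
    simp only [dotProduct_add, dotProduct_smul, smul_eq_mul]
    ring

variable [DecidableEq V] {M : Matrix V V ℝ}

theorem dotProduct_mulVec_eq_sum_eigenvalues (hM : M.IsHermitian) (x : V → ℝ) :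
    x ⬝ᵥ M *ᵥ x = ∑ j, hM.eigenvalues j * ((hM.eigenvectorBasis j).ofLp ⬝ᵥ x) ^ 2 := by
  have h := hM.eigenvectorBasis.sum_inner_mul_inner (WithLp.toLp 2 x) (WithLp.toLp 2 (M *ᵥ x))
  simp only [EuclideanSpace.inner_eq_star_dotProduct, star_trivial] at h
  rw [dotProduct_comm, ← h]
  refine Finset.sum_congr rfl fun j _ => ?_
  have hMT : Mᵀ = M := by simpa [Matrix.IsHermitian, conjTranspose_eq_transpose_of_trivial] using hM
  have h2 : (M *ᵥ x) ⬝ᵥ (hM.eigenvectorBasis j).ofLp =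
      hM.eigenvalues j * ((hM.eigenvectorBasis j).ofLp ⬝ᵥ x) := by
    rw [dotProduct_comm, dotProduct_mulVec, ← mulVec_transpose, hMT, hM.mulVec_eigenvectorBasis,
      smul_dotProduct, smul_eq_mul]
  rw [h2]
  ring

theorem dotProduct_self_eq_sum (hM : M.IsHermitian) (x : V → ℝ) :
    x ⬝ᵥ x = ∑ j, ((hM.eigenvectorBasis j).ofLp ⬝ᵥ x) ^ 2 := by
  have h := hM.eigenvectorBasis.sum_inner_mul_inner (WithLp.toLp 2 x) (WithLp.toLp 2 x)
  simp only [EuclideanSpace.inner_eq_star_dotProduct, star_trivial] at h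
  rw [← h]
  refine Finset.sum_congr rfl fun j _ => ?_
  rw [dotProduct_comm x]
  ring

/-- A plane contains a nonzero vector orthogonal to the exceptional eigenvector, and on it only
eigenvalues below `c` contribute. -/
theorem exists_dotProduct_mulVec_lt (hM : M.IsHermitian) {c : ℝ} (j₀ : V)
    (hj : ∀ j ≠ j₀, hM.eigenvalues j < c) {y z : V → ℝ}
    (hyz : ∀ α β : ℝ, α • y + β • z = 0 → α = 0 ∧ β = 0) :
    ∃ α β : ℝ, (α • y + β • z) ⬝ᵥ M *ᵥ (α • y + β • z) <
      c * ((α • y + β • z) ⬝ᵥ (α • y + β • z)) := by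
  obtain ⟨α, β, hne, horth⟩ :=
    exists_combination_orthogonal hyz (hM.eigenvectorBasis j₀).ofLp
  refine ⟨α, β, ?_⟩
  generalize α • y + β • z = x at hne horth ⊢
  rw [dotProduct_mulVec_eq_sum_eigenvalues hM, dotProduct_self_eq_sum hM, Finset.mul_sum]
  have hpos : ∑ j, ((hM.eigenvectorBasis j).ofLp ⬝ᵥ x) ^ 2 ≠ 0 := by
    rw [← dotProduct_self_eq_sum hM]
    exact fun h => hne (dotProduct_self_eq_zero.1 h)
  obtain ⟨j₁, -, h1⟩ := Finset.exists_ne_zero_of_sum_ne_zero hpos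
  refine Finset.sum_lt_sum (fun j _ => ?_) ⟨j₁, Finset.mem_univ _, ?_⟩
  · by_cases h : j = j₀
    · simp [h, horth]
    · exact mul_le_mul_of_nonneg_right (hj j h).le (sq_nonneg _)
  · refine mul_lt_mul_of_pos_right (hj j₁ ?_) (lt_of_le_of_ne (sq_nonneg _) h1.symm)
    rintro rfl
    simp [horth] at h1

theorem exists_lt_dotProduct_mulVec (hM : M.IsHermitian) {c : ℝ} (j₀ : V)
    (hj : ∀ j ≠ j₀, c < hM.eigenvalues j) {y z : V → ℝ}
    (hyz : ∀ α β : ℝ, α • y + β • z = 0 → α = 0 ∧ β = 0) :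
    ∃ α β : ℝ, c * ((α • y + β • z) ⬝ᵥ (α • y + β • z)) <
      (α • y + β • z) ⬝ᵥ M *ᵥ (α • y + β • z) := by
  obtain ⟨α, β, hne, horth⟩ :=
    exists_combination_orthogonal hyz (hM.eigenvectorBasis j₀).ofLp
  refine ⟨α, β, ?_⟩
  generalize α • y + β • z = x at hne horth ⊢
  rw [dotProduct_mulVec_eq_sum_eigenvalues hM, dotProduct_self_eq_sum hM, Finset.mul_sum]
  have hpos : ∑ j, ((hM.eigenvectorBasis j).ofLp ⬝ᵥ x) ^ 2 ≠ 0 := by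
    rw [← dotProduct_self_eq_sum hM]
    exact fun h => hne (dotProduct_self_eq_zero.1 h)
  obtain ⟨j₁, -, h1⟩ := Finset.exists_ne_zero_of_sum_ne_zero hpos
  refine Finset.sum_lt_sum (fun j _ => ?_) ⟨j₁, Finset.mem_univ _, ?_⟩
  · by_cases h : j = j₀
    · simp [h, horth]
    · exact mul_le_mul_of_nonneg_right (hj j h).le (sq_nonneg _)
  · refine mul_lt_mul_of_pos_right (hj j₁ ?_) (lt_of_le_of_ne (sq_nonneg _) h1.symm)
    rintro rfl
    simp [horth] at h1

theorem le_second_largest_eigenvalue (hM : M.IsHermitian) (hcard : 2 ≤ Fintype.card V) {c : ℝ}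
    {y z : V → ℝ} (hyz : ∀ α β : ℝ, α • y + β • z = 0 → α = 0 ∧ β = 0)
    (hc : ∀ α β : ℝ, c * ((α • y + β • z) ⬝ᵥ (α • y + β • z)) ≤
      (α • y + β • z) ⬝ᵥ M *ᵥ (α • y + β • z)) :
    c ≤ ithLargestEigenvalue hM 2 := by
  by_contra! hlt
  rw [ithLargestEigenvalue, dif_pos ⟨by omega, hcard⟩] at hlt
  -- This is the bijection by which `eigenvalues` is defined from `eigenvalues₀`, so excluding `φ 0`
  -- leaves the indices from 1 on.
  let φ : Fin (Fintype.card V) ≃ V := Fintype.equivOfCardEq (Fintype.card_fin _)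
  obtain ⟨α, β, h⟩ := exists_dotProduct_mulVec_lt hM (c := c) (φ ⟨0, by omega⟩) (fun j hj => by
    refine lt_of_le_of_lt (hM.eigenvalues₀_antitone ?_) hlt
    rw [Fin.le_def]
    have h0 : φ.symm j ≠ ⟨0, by omega⟩ := fun h => hj (by rw [← h, Equiv.apply_symm_apply])
    have h1 : (φ.symm j).1 ≠ 0 := fun h => h0 (Fin.ext h)
    exact Nat.one_le_iff_ne_zero.2 h1) hyz
  exact absurd (hc α β) (not_le.2 h)

theorem second_smallest_eigenvalue_le (hM : M.IsHermitian) (hcard : 2 ≤ Fintype.card V) {c : ℝ}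
    {y z : V → ℝ} (hyz : ∀ α β : ℝ, α • y + β • z = 0 → α = 0 ∧ β = 0)
    (hc : ∀ α β : ℝ, (α • y + β • z) ⬝ᵥ M *ᵥ (α • y + β • z) ≤
      c * ((α • y + β • z) ⬝ᵥ (α • y + β • z))) :
    ithLargestEigenvalue hM (Fintype.card V - 1) ≤ c := by
  by_contra! hlt
  rw [ithLargestEigenvalue, dif_pos ⟨by omega, by omega⟩] at hlt
  let φ : Fin (Fintype.card V) ≃ V := Fintype.equivOfCardEq (Fintype.card_fin _)
  obtain ⟨α, β, h⟩ := exists_lt_dotProduct_mulVec hM (c := c)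
    (φ ⟨Fintype.card V - 1, by omega⟩) (fun j hj => by
    refine lt_of_lt_of_le hlt (hM.eigenvalues₀_antitone ?_)
    rw [Fin.le_def]
    have h0 : φ.symm j ≠ ⟨Fintype.card V - 1, by omega⟩ := fun h =>
      hj (by rw [← h, Equiv.apply_symm_apply])
    have h1 : (φ.symm j).1 ≠ Fintype.card V - 1 := fun h => h0 (Fin.ext h)
    have h2 := (φ.symm j).2
    -- The (n-1)-th largest eigenvalue has zero-based index n - 2.
    change (φ.symm j).1 ≤ Fintype.card V - 1 - 1
    omega) hyz
  exact absurd (hc α β) (not_le.2 h)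

end Spectral

/-! ### The Laplacian form on two disjoint sets -/

section TwoParts

open Matrix

variable {V : Type*} [DecidableEq V]

/-- The indicator vector of a set of vertices. -/
def indicatorVec (S : Finset V) : V → ℝ := fun v => if v ∈ S then 1 else 0

theorem indicatorVec_combination_eq_zero {S T : Finset V} (hST : Disjoint S T) (hS : S.Nonempty)
    (hT : T.Nonempty) (α β : ℝ) (h : α • indicatorVec S + β • indicatorVec T = 0) : α = 0 ∧ β = 0 := by
  obtain ⟨a, ha⟩ := hS
  obtain ⟨b, hb⟩ := hT
  have h1 := congrFun h a
  have h2 := congrFun h b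
  simp [indicatorVec, ha, Finset.disjoint_left.1 hST ha] at h1
  simp [indicatorVec, hb, Finset.disjoint_right.1 hST hb] at h2
  exact ⟨h1, h2⟩

variable [Fintype V]

theorem indicatorVec_dotProduct (S : Finset V) (x : V → ℝ) :
    indicatorVec S ⬝ᵥ x = ∑ v ∈ S, x v := by
  simp [indicatorVec, dotProduct, Finset.sum_ite_mem]

variable (G : SimpleGraph V) [DecidableRel G.Adj] {S T : Finset V}

/-- The number of edges between `S` and `T`, for disjoint `S` and `T`. -/
def edgesBetween (S T : Finset V) : ℕ := ∑ v ∈ S, (G.neighborFinset v ∩ T).card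

theorem indicatorVec_lapMatrix_self (S : Finset V) :
    indicatorVec S ⬝ᵥ G.lapMatrix ℝ *ᵥ indicatorVec S =
      ((∑ v ∈ S, outDegree G S v : ℕ) : ℝ) := by
  rw [indicatorVec_dotProduct, Nat.cast_sum]
  refine Finset.sum_congr rfl fun v hv => ?_
  rw [SimpleGraph.lapMatrix_mulVec_apply]
  have h := Finset.card_inter_add_card_sdiff (G.neighborFinset v) S
  rw [SimpleGraph.card_neighborFinset_eq_degree] at h
  have h' : (G.degree v : ℝ) = (G.neighborFinset v ∩ S).card + (G.neighborFinset v \ S).card := by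
    exact_mod_cast h.symm
  simp [indicatorVec, hv, outDegree, h']

theorem indicatorVec_lapMatrix_of_disjoint (hST : Disjoint S T) :
    indicatorVec S ⬝ᵥ G.lapMatrix ℝ *ᵥ indicatorVec T = -(edgesBetween G S T : ℝ) := by
  rw [indicatorVec_dotProduct, edgesBetween, Nat.cast_sum, ← Finset.sum_neg_distrib]
  refine Finset.sum_congr rfl fun v hv => ?_
  rw [SimpleGraph.lapMatrix_mulVec_apply]
  simp [indicatorVec, Finset.disjoint_left.1 hST hv]

theorem lapMatrix_quadratic_form (hST : Disjoint S T) (α β : ℝ) :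
    (α • indicatorVec S + β • indicatorVec T) ⬝ᵥ
        G.lapMatrix ℝ *ᵥ (α • indicatorVec S + β • indicatorVec T) =
      α ^ 2 * ((∑ v ∈ S, outDegree G S v : ℕ) : ℝ) +
      β ^ 2 * ((∑ v ∈ T, outDegree G T v : ℕ) : ℝ) - 2 * α * β * edgesBetween G S T := by
  have hsymm : indicatorVec T ⬝ᵥ G.lapMatrix ℝ *ᵥ indicatorVec S =
      indicatorVec S ⬝ᵥ G.lapMatrix ℝ *ᵥ indicatorVec T := by
    rw [dotProduct_mulVec, ← mulVec_transpose, (G.isSymm_lapMatrix (R := ℝ)).eq, dotProduct_comm]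
  simp only [mulVec_add, mulVec_smul, dotProduct_add, add_dotProduct, smul_dotProduct,
    dotProduct_smul, smul_eq_mul, hsymm, indicatorVec_lapMatrix_self,
    indicatorVec_lapMatrix_of_disjoint G hST]
  ring

theorem indicatorVec_combination_dotProduct_self (hST : Disjoint S T) (α β : ℝ) :
    (α • indicatorVec S + β • indicatorVec T) ⬝ᵥ (α • indicatorVec S + β • indicatorVec T) =
      α ^ 2 * S.card + β ^ 2 * T.card := by
  have h1 : ∀ S : Finset V, indicatorVec S ⬝ᵥ indicatorVec S = S.card := fun S => by
    simp [indicatorVec_dotProduct, indicatorVec]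
  have h2 : indicatorVec S ⬝ᵥ indicatorVec T = 0 := by
    rw [indicatorVec_dotProduct]
    exact Finset.sum_eq_zero fun v hv => if_neg (Finset.disjoint_left.1 hST hv)
  have h3 : indicatorVec T ⬝ᵥ indicatorVec S = 0 := by rw [dotProduct_comm, h2]
  simp only [dotProduct_add, add_dotProduct, smul_dotProduct, dotProduct_smul, smul_eq_mul, h1, h2,
    h3]
  ring

theorem mul_self_form_nonneg {a b e : ℝ} (ha : 0 ≤ a) (hb : 0 ≤ b) (he : e ^ 2 ≤ a * b) (α β : ℝ) :
    0 ≤ α ^ 2 * a + β ^ 2 * b + 2 * α * β * e := by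
  rcases ha.eq_or_lt with rfl | ha
  · have : e = 0 := by nlinarith [sq_nonneg e]
    subst this
    nlinarith [mul_nonneg (sq_nonneg β) hb]
  · refine nonneg_of_mul_nonneg_right (a := a) ?_ ha
    nlinarith [sq_nonneg (a * α + e * β), mul_nonneg (sq_nonneg β) (sub_nonneg.2 he)]

/-- The difference m(α² + β²) minus the Laplacian form is a binary quadratic form, nonnegative by
the discriminant condition `he`; and m ≤ (m / N)|S|, likewise for T. -/
theorem lapMatrix_form_le {m N : ℝ} (hm : 0 ≤ m) (hN : 0 < N) (hST : Disjoint S T)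
    (hS : N ≤ S.card) (hT : N ≤ T.card)
    (hdS : ((∑ v ∈ S, outDegree G S v : ℕ) : ℝ) ≤ m)
    (hdT : ((∑ v ∈ T, outDegree G T v : ℕ) : ℝ) ≤ m)
    (he : (edgesBetween G S T : ℝ) ^ 2 ≤ (m - ((∑ v ∈ S, outDegree G S v : ℕ) : ℝ)) *
      (m - ((∑ v ∈ T, outDegree G T v : ℕ) : ℝ))) (α β : ℝ) :
    (α • indicatorVec S + β • indicatorVec T) ⬝ᵥ
        G.lapMatrix ℝ *ᵥ (α • indicatorVec S + β • indicatorVec T) ≤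
      m / N * ((α • indicatorVec S + β • indicatorVec T) ⬝ᵥ
        (α • indicatorVec S + β • indicatorVec T)) := by
  rw [lapMatrix_quadratic_form G hST, indicatorVec_combination_dotProduct_self hST]
  have h := mul_self_form_nonneg (sub_nonneg.2 hdS) (sub_nonneg.2 hdT) he α β
  have h1 : ∀ n : ℝ, N ≤ n → m ≤ m / N * n := fun n hn => by
    rw [div_mul_eq_mul_div, le_div_iff₀ hN]
    exact mul_le_mul_of_nonneg_left hn hm
  have h2 := mul_le_mul_of_nonneg_left (h1 _ hS) (sq_nonneg α)
  have h3 := mul_le_mul_of_nonneg_left (h1 _ hT) (sq_nonneg β)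
  linarith

theorem le_dotProduct_degMatrix_mulVec {δ : ℕ} (hδ : ∀ v, δ ≤ G.degree v) (x : V → ℝ) :
    (δ : ℝ) * (x ⬝ᵥ x) ≤ x ⬝ᵥ G.degMatrix ℝ *ᵥ x := by
  rw [SimpleGraph.dotProduct_mulVec_degMatrix, dotProduct, Finset.mul_sum]
  refine Finset.sum_le_sum fun v _ => ?_
  rw [mul_assoc]
  exact mul_le_mul_of_nonneg_right (by exact_mod_cast hδ v) (mul_self_nonneg _)

/-- Two disjoint vertex sets with few outgoing edges bound the second eigenvalues of `G`. -/
theorem eigenvalue_bounds_of_two_parts {δ : ℕ} (hδ : ∀ v, δ ≤ G.degree v) {c : ℝ}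
    (hST : Disjoint S T) (hS : S.Nonempty) (hT : T.Nonempty)
    (hc : ∀ α β : ℝ, (α • indicatorVec S + β • indicatorVec T) ⬝ᵥ
        G.lapMatrix ℝ *ᵥ (α • indicatorVec S + β • indicatorVec T) ≤
      c * ((α • indicatorVec S + β • indicatorVec T) ⬝ᵥ
        (α • indicatorVec S + β • indicatorVec T))) :
    δ - c ≤ adjEigenvalue G 2 ∧ lapEigenvalue G (Fintype.card V - 1) ≤ c ∧
      2 * δ - c ≤ signlessLapEigenvalue G 2 := by
  have hcard : 2 ≤ Fintype.card V := by
    have h1 := hS.card_pos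
    have h2 := hT.card_pos
    have h3 := Finset.card_le_univ (S ∪ T)
    rw [Finset.card_union_of_disjoint hST] at h3
    omega
  have hind := indicatorVec_combination_eq_zero hST hS hT
  refine ⟨le_second_largest_eigenvalue _ hcard hind fun α β => ?_,
    second_smallest_eigenvalue_le _ hcard hind hc,
    le_second_largest_eigenvalue _ hcard hind fun α β => ?_⟩
  -- Both bounds come from A = D - L and D + A = 2D - L, with D at least δ.
  all_goals
    have h1 := hc α β
    generalize α • indicatorVec S + β • indicatorVec T = x at h1 ⊢
    have h2 := le_dotProduct_degMatrix_mulVec G hδ x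
    rw [SimpleGraph.lapMatrix, sub_mulVec, dotProduct_sub] at h1
  · linarith
  · rw [signlessLapMatrix, add_mulVec, dotProduct_add]
    linarith

end TwoParts

/-! ### Selecting two parts -/

/-- If the parts of a partition send out few edges on average, two of them send out few edges and
have few edges between them. -/
theorem exists_pair_of_sum_le {ι : Type*} [Fintype ι] [DecidableEq ι] [Nonempty ι] {k : ℤ}
    (d : ι → ℤ) (e : ι → ι → ℤ) (he : ∀ i j, 0 ≤ e i j)
    (hed : ∀ i, ∑ j ∈ Finset.univ.erase i, e i j ≤ d i)
    (hsum : ∑ i, d i + 2 * k + 2 ≤ 2 * k * Fintype.card ι) :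
    ∃ i j, i ≠ j ∧ d i ≤ 2 * k - 1 ∧ d j ≤ 2 * k - 1 ∧
      e i j ^ 2 ≤ (2 * k - 1 - d i) * (2 * k - 1 - d j) := by
  by_contra! hall
  -- By minimality of `d i`, failure for (i, j) gives e² > (2k - 1 - d j)² whenever d j ≤ 2k - 1,
  -- hence e ≥ 2k - d j by integrality.
  obtain ⟨i, hi⟩ := Finite.exists_min d
  have h1 : ∀ j ∈ Finset.univ.erase i, 2 * k - d j ≤ e i j := by
    intro j hj
    have hij : i ≠ j := (Finset.ne_of_mem_erase hj).symm
    by_cases hdj : d j ≤ 2 * k - 1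
    · have h2 := hall i j hij ((hi j).trans hdj) hdj
      have h3 := he i j
      by_contra! hlt
      nlinarith [hi j]
    · have := he i j
      omega
  have h2 := (Finset.sum_le_sum h1).trans (hed i)
  rw [Finset.sum_sub_distrib, Finset.sum_const, Finset.card_erase_of_mem (Finset.mem_univ i),
    Finset.card_univ, nsmul_eq_mul, Nat.cast_sub Fintype.card_pos] at h2
  have h3 := Finset.add_sum_erase Finset.univ d (Finset.mem_univ i)
  push_cast at h2
  nlinarith

/-! ### Counting edges across a partition -/

section Partition

variable {V : Type*} [Fintype V] [DecidableEq V] (G : SimpleGraph V) [DecidableRel G.Adj]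
  {ι : Type*} [Fintype ι] [DecidableEq ι] (p : V → ι)

theorem sum_edgesBetween_eq (i : ι) :
    ∑ j ∈ Finset.univ.erase i, edgesBetween G (Finset.univ.filter (p · = i))
      (Finset.univ.filter (p · = j)) =
    ∑ v ∈ Finset.univ.filter (p · = i), outDegree G (Finset.univ.filter (p · = i)) v := by
  unfold edgesBetween
  rw [Finset.sum_comm]
  refine Finset.sum_congr rfl fun v _ => ?_
  rw [outDegree, Finset.card_eq_sum_card_fiberwise (f := p) (t := Finset.univ.erase i)]
  · refine Finset.sum_congr rfl fun j hj => ?_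
    congr 1
    ext w
    have := Finset.ne_of_mem_erase hj
    simp only [Finset.mem_inter, Finset.mem_filter, Finset.mem_univ, true_and, Finset.mem_sdiff]
    constructor
    · rintro ⟨h1, h2⟩
      exact ⟨⟨h1, by rwa [h2]⟩, h2⟩
    · rintro ⟨⟨h1, -⟩, h2⟩
      exact ⟨h1, h2⟩
  · intro w hw
    simpa using (Finset.mem_sdiff.1 hw).2

theorem sum_outDegree_eq_card_crossing :
    ∑ i, ∑ v ∈ Finset.univ.filter (p · = i), outDegree G (Finset.univ.filter (p · = i)) v =
      Nat.card {x : V × V // G.Adj x.1 x.2 ∧ p x.1 ≠ p x.2} := by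
  have h1 : ∀ i, ∑ v ∈ Finset.univ.filter (p · = i), outDegree G (Finset.univ.filter (p · = i)) v =
      ∑ v ∈ Finset.univ.filter (p · = i), outDegree G (Finset.univ.filter (p · = p v)) v := by
    intro i
    refine Finset.sum_congr rfl fun v hv => ?_
    rw [(Finset.mem_filter.1 hv).2]
  rw [Finset.sum_congr rfl fun i _ => h1 i, Finset.sum_fiberwise, Nat.card_eq_fintype_card,
    Fintype.card_subtype, Finset.card_filter, Fintype.sum_prod_type]
  refine Finset.sum_congr rfl fun v _ => ?_
  rw [← Finset.card_filter, outDegree]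
  congr 1
  ext w
  simp [eq_comm]

end Partition

/-! ### Assembling the bounds -/

theorem eigenvalue_bounds_of_not_hasPacking {V : Type*} [Fintype V] [DecidableEq V]
    (G : SimpleGraph V) [DecidableRel G.Adj] {δ g k : ℕ} (hδ : ∀ v, δ ≤ G.degree v)
    (hg3 : 3 ≤ g) (hg : (g : ℕ∞) ≤ G.egirth) [Nonempty V] (hk : 1 ≤ k) (hδk : 2 * k ≤ δ)
    (h : ¬ HasPacking G k) :
    δ - (2 * (k : ℝ) - 1) / nOneStar δ g ≤ adjEigenvalue G 2 ∧
      lapEigenvalue G (Fintype.card V - 1) ≤ (2 * (k : ℝ) - 1) / nOneStar δ g ∧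
      2 * δ - (2 * (k : ℝ) - 1) / nOneStar δ g ≤ signlessLapEigenvalue G 2 := by
  classical
  obtain ⟨H, hH⟩ := exists_partition_of_not_hasPacking G h
  let P : H.ConnectedComponent → Finset V := fun i =>
    Finset.univ.filter (H.connectedComponentMk · = i)
  let d : H.ConnectedComponent → ℕ := fun i => ∑ v ∈ P i, outDegree G (P i) v
  have hne : ∀ i, (P i).Nonempty := fun i => by
    obtain ⟨v, rfl⟩ := i.exists_rep
    exact ⟨v, Finset.mem_filter.2 ⟨Finset.mem_univ _, rfl⟩⟩
  rw [← sum_outDegree_eq_card_crossing G H.connectedComponentMk, Nat.card_eq_fintype_card] at hH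
  obtain ⟨i, j, hij, hi, hj, he⟩ := exists_pair_of_sum_le (k := k) (fun i => (d i : ℤ))
    (fun i j => (edgesBetween G (P i) (P j) : ℤ)) (fun _ _ => Int.natCast_nonneg _)
    (fun i => by exact_mod_cast (sum_edgesBetween_eq G H.connectedComponentMk i).le)
    (by exact_mod_cast hH)
  have hdisj : Disjoint (P i) (P j) := by
    rw [Finset.disjoint_left]
    intro v hvi hvj
    exact hij ((Finset.mem_filter.1 hvi).2.symm.trans (Finset.mem_filter.1 hvj).2)
  -- Here δ ≥ 2k enters: at most 2k - 1 outgoing edges means fewer than δ.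
  have hN : ∀ i, (d i : ℤ) ≤ 2 * k - 1 → nOneStar δ g ≤ (P i).card := fun i hi =>
    nOneStar_le_card hδ (by omega) hg3 hg (hne i) (by change d i < δ; omega)
  have hNpos : 0 < nOneStar δ g := by
    unfold nOneStar
    dsimp only
    split_ifs <;> omega
  have hk' : (1 : ℝ) ≤ k := by exact_mod_cast hk
  refine eigenvalue_bounds_of_two_parts G hδ hdisj (hne i) (hne j)
    (lapMatrix_form_le G (by linarith) (by exact_mod_cast hNpos) hdisj
      (by exact_mod_cast hN i hi) (by exact_mod_cast hN j hj) ?_ ?_ ?_)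
  · change ((d i : ℕ) : ℝ) ≤ _
    exact_mod_cast hi
  · change ((d j : ℕ) : ℝ) ≤ _
    exact_mod_cast hj
  · change _ ≤ (_ - ((d i : ℕ) : ℝ)) * (_ - ((d j : ℕ) : ℝ))
    exact_mod_cast he

end SpanningTreePacking

theorem corollary1p7 {V : Type*} [Fintype V] [DecidableEq V]
    (G : SimpleGraph V) [DecidableRel G.Adj] (n δ g k : ℕ)
    (hn : Fintype.card V = n) (hδ : G.minDegree = δ)
    (hg : 3 ≤ g) (hgirth : G.egirth = (g : ℕ∞))
    (hk : 2 ≤ k) (hδk : 2 * k ≤ δ) :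
    (SpanningTreePacking.adjEigenvalue G 2
        < (δ : ℝ) - (2 * (k : ℝ) - 1) / (SpanningTreePacking.nOneStar δ g : ℝ) →
      (k : ℕ∞) ≤ SpanningTreePacking.tau G) ∧
    (SpanningTreePacking.lapEigenvalue G (n - 1)
        > (2 * (k : ℝ) - 1) / (SpanningTreePacking.nOneStar δ g : ℝ) →
      (k : ℕ∞) ≤ SpanningTreePacking.tau G) ∧
    (SpanningTreePacking.signlessLapEigenvalue G 2
        < 2 * (δ : ℝ) - (2 * (k : ℝ) - 1) / (SpanningTreePacking.nOneStar δ g : ℝ) →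
      (k : ℕ∞) ≤ SpanningTreePacking.tau G) := by
  by_cases h : SpanningTreePacking.HasPacking G k
  · have : (k : ℕ∞) ≤ SpanningTreePacking.tau G :=
      le_iSup₂ (f := fun (m : ℕ) (_ : SpanningTreePacking.HasPacking G m) => (m : ℕ∞)) k h
    exact ⟨fun _ => this, fun _ => this, fun _ => this⟩
  -- On an empty vertex set `minDegree` is 0, against δ ≥ 4.
  · have : Nonempty V := by
      by_contra hV
      rw [not_nonempty_iff] at hV
      rw [SimpleGraph.minDegree_of_subsingleton] at hδ
      omega
    obtain ⟨h1, h2, h3⟩ := SpanningTreePacking.eigenvalue_bounds_of_not_hasPacking G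
      (fun v => hδ ▸ G.minDegree_le_degree v) hg hgirth.ge (by omega) hδk h
    subst hn
    exact ⟨fun h' => absurd h1 (not_le.2 h'), fun h' => absurd h2 (not_le.2 h'),
      fun h' => absurd h3 (not_le.2 h')⟩
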